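/- Let $A$ be a simple unital $C^*$-algebra (with $1\neq 0$), and let $\alpha\colon\mathbb{T}\to\mathrm{Aut}(A)$ be a continuous action of the circle group, i.e. a group homomorphism such that $\zeta\mapsto\alpha_\zeta(a)$ is norm continuous for every $a\in A$. Assume that $\alpha$ has the Rokhlin property: for every $\varepsilon>0$ and every finite subset $F\subseteq A$ there is a unitary $u\in A$ such that $\|\alpha_\zeta(u)-\zeta u\|<\varepsilon$ for all $\zeta\in\mathbb{T}$ and $\|ua-au\|<\varepsilon$ for all $a\in F$. Then the fixed point algebra $A^\alpha=\{a\in A:\alpha_\zeta(a)=a\text{ for all }\zeta\in\mathbb{T}\}$ and the (full) crossed product $A\rtimes_\alpha\mathbb{T}$ are simple $C^*$-algebras. Here a $C^*$-algebra is simple if it is nonzero and its only closed two-sided ideals are $\{0\}$ and itself. The crossed product $A\rtimes_\alpha\mathbb{T}$ is the completion of the convolution algebra $C(\mathbb{T},A)$ in the universal norm $\|f\|=\sup_{(\pi,v)}\bigl\|\int_{\mathbb{T}}\pi(f(\zeta))v_\zeta\,d\zeta\bigr\|$, the supremum being over all covariant representations $(\pi,v)$ of $(A,\mathbb{T},\alpha)$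 on Hilbert spaces, with $\pi$ unital and $v$ strongly continuous. -/

import Mathlib

open scoped ENNReal

noncomputable section

universe u

/-- A C*-algebra is simple if it is nonzero and has no closed two-sided ideals besides zero and
itself. -/
def IsSimpleCStarAlgebra (B : Type*) [NonUnitalCStarAlgebra B] : Prop :=
  Nontrivial B ∧ ∀ I : TwoSidedIdeal B, IsClosed (I : Set B) → I = ⊥ ∨ I = ⊤

namespace CircleAction

variable {A : Type u} [CStarAlgebra A]

/-- Continuity of a circle action, for the topology of pointwise norm convergence on `Aut(A)`. -/
def IsContinuous (α : Circle →* (A ≃⋆ₐ[ℂ] A)) : Prop :=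
  ∀ a : A, Continuous fun ζ : Circle => α ζ a

/-- The Rokhlin property for a circle action on a unital C*-algebra. -/
def RokhlinProperty (α : Circle →* (A ≃⋆ₐ[ℂ] A)) : Prop :=
  ∀ ε : ℝ, 0 < ε → ∀ F : Finset A, ∃ u ∈ unitary A,
    (∀ ζ : Circle, ‖α ζ u - (ζ : ℂ) • u‖ < ε) ∧ ∀ a ∈ F, ‖u * a - a * u‖ < ε

/-- The fixed point algebra `A^α`. -/
def fixedPointAlgebra (α : Circle →* (A ≃⋆ₐ[ℂ] A)) : StarSubalgebra ℂ A where
  carrier := {a | ∀ ζ : Circle, α ζ a = a}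
  mul_mem' ha hb ζ := by rw [map_mul, ha ζ, hb ζ]
  add_mem' ha hb ζ := by rw [map_add, ha ζ, hb ζ]
  algebraMap_mem' r ζ := by rw [Algebra.algebraMap_eq_smul_one, map_smul, map_one]
  star_mem' ha ζ := by rw [map_star, ha ζ]

theorem isClosed_fixedPointAlgebra (α : Circle →* (A ≃⋆ₐ[ℂ] A)) :
    IsClosed (fixedPointAlgebra α : Set A) := by
  have h : (fixedPointAlgebra α : Set A) = ⋂ ζ : Circle, {a | α ζ a = a} := by
    ext a
    simp only [Set.mem_iInter]
    exact Iff.rfl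
  rw [h]
  exact isClosed_iInter fun ζ =>
    isClosed_eq (StarAlgEquiv.isometry (α ζ)).continuous continuous_id

instance instCStarAlgebraFixedPointAlgebra (α : Circle →* (A ≃⋆ₐ[ℂ] A)) :
    CStarAlgebra (fixedPointAlgebra α) :=
  StarSubalgebra.cstarAlgebra (fixedPointAlgebra α) (h_closed := isClosed_fixedPointAlgebra α)

/-- A (nondegenerate) covariant representation of `(A, 𝕋, α)` on a Hilbert space: a unital
`*`-representation `π` of `A` and a strongly continuous unitary representation `v` of the circle
with `v_ζ π(a) v_ζ* = π(α_ζ(a))`. -/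
structure CovariantRep (α : Circle →* (A ≃⋆ₐ[ℂ] A)) where
  H : Type u
  [normedAddCommGroup : NormedAddCommGroup H]
  [innerProductSpace : InnerProductSpace ℂ H]
  [completeSpace : CompleteSpace H]
  π : A →⋆ₐ[ℂ] (H →L[ℂ] H)
  v : Circle →* unitary (H →L[ℂ] H)
  continuous_v : ∀ ξ : H, Continuous fun ζ : Circle => (v ζ : H →L[ℂ] H) ξ
  covariant : ∀ (ζ : Circle) (a : A),
    (v ζ : H →L[ℂ] H) * π a * star (v ζ : H →L[ℂ] H) = π (α ζ a)

attribute [instance] CovariantRep.normedAddCommGroup CovariantRep.innerProductSpace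
  CovariantRep.completeSpace

namespace CovariantRep

variable {α : Circle →* (A ≃⋆ₐ[ℂ] A)} (ρ : CovariantRep α)

theorem norm_π_le (a : A) : ‖ρ.π a‖ ≤ ‖a‖ := NonUnitalStarAlgHom.norm_apply_le ρ.π a

theorem continuous_integrand (f : C(Circle, A)) (ξ : ρ.H) :
    Continuous fun t : AddCircle (1 : ℝ) =>
      ρ.π (f t.toCircle) ((ρ.v t.toCircle : ρ.H →L[ℂ] ρ.H) ξ) := by
  have hπ : Continuous ρ.π :=
    AddMonoidHomClass.continuous_of_bound ρ.π 1 fun a => by simpa using ρ.norm_π_le a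
  exact (hπ.comp (f.continuous.comp AddCircle.continuous_toCircle)).clm_apply
    ((ρ.continuous_v ξ).comp AddCircle.continuous_toCircle)

theorem norm_integrand_le (f : C(Circle, A)) (ξ : ρ.H) (ζ : Circle) :
    ‖ρ.π (f ζ) ((ρ.v ζ : ρ.H →L[ℂ] ρ.H) ξ)‖ ≤ ‖f‖ * ‖ξ‖ := by
  calc _ ≤ ‖ρ.π (f ζ)‖ * ‖(ρ.v ζ : ρ.H →L[ℂ] ρ.H) ξ‖ := ContinuousLinearMap.le_opNorm _ _
    _ ≤ ‖f‖ * ‖ξ‖ := by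
      gcongr
      · exact (ρ.norm_π_le _).trans (f.norm_coe_le_norm ζ)
      · exact (ContinuousLinearMap.norm_map_of_mem_unitary (ρ.v ζ).2 ξ).le

theorem integrable_integrand (f : C(Circle, A)) (ξ : ρ.H) :
    MeasureTheory.Integrable (fun t : AddCircle (1 : ℝ) =>
      ρ.π (f t.toCircle) ((ρ.v t.toCircle : ρ.H →L[ℂ] ρ.H) ξ)) AddCircle.haarAddCircle :=
  (ρ.continuous_integrand f ξ).integrable_of_hasCompactSupport
    (HasCompactSupport.of_compactSpace _)

/-- The integrated form `(π ⋊ v)(f) ξ = ∫_𝕋 π(f(ζ)) v_ζ ξ dζ` of a covariant representation, for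
the normalized Haar measure; here the circle is parametrized by `ℝ/ℤ`. -/
def integrated (f : C(Circle, A)) : ρ.H →L[ℂ] ρ.H :=
  LinearMap.mkContinuous
    { toFun := fun ξ => ∫ t : AddCircle (1 : ℝ),
        ρ.π (f t.toCircle) ((ρ.v t.toCircle : ρ.H →L[ℂ] ρ.H) ξ) ∂AddCircle.haarAddCircle
      map_add' := fun ξ η => by
        simp only [map_add]
        exact MeasureTheory.integral_add (ρ.integrable_integrand f ξ) (ρ.integrable_integrand f η)
      map_smul' := fun c ξ => by
        simp only [map_smul, RingHom.id_apply]
        exact MeasureTheory.integral_smul c _ }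
    ‖f‖ fun ξ => by
      simpa using MeasureTheory.norm_integral_le_of_norm_le_const
        (μ := AddCircle.haarAddCircle (T := (1 : ℝ)))
        (Filter.Eventually.of_forall fun t => ρ.norm_integrand_le f ξ t.toCircle)

theorem norm_integrated_le (f : C(Circle, A)) : ‖ρ.integrated f‖ ≤ ‖f‖ :=
  LinearMap.mkContinuous_norm_le _ (norm_nonneg f) _

end CovariantRep

/-- The universal integrated form: the direct sum of the integrated forms of all covariant
representations (on Hilbert spaces in the universe of `A`, which suffices for all cyclic ones).
Its norm is the universal norm `f ↦ sup ‖(π ⋊ v)(f)‖` on `C(𝕋, A)`. -/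
def universalIntegrated (α : Circle →* (A ≃⋆ₐ[ℂ] A)) (f : C(Circle, A)) :
    lp (fun ρ : CovariantRep α => ρ.H →L[ℂ] ρ.H) ∞ :=
  ⟨fun ρ => ρ.integrated f,
    memℓp_infty ⟨‖f‖, by rintro _ ⟨ρ, rfl⟩; exact ρ.norm_integrated_le f⟩⟩

/-- The (full) crossed product `A ⋊_α 𝕋`: the completion of the convolution `*`-algebra `C(𝕋, A)`
in the universal norm, realized as the C*-algebra generated by its image under the universal
integrated form. -/
def crossedProduct (α : Circle →* (A ≃⋆ₐ[ℂ] A)) :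
    NonUnitalStarSubalgebra ℂ (lp (fun ρ : CovariantRep α => ρ.H →L[ℂ] ρ.H) ∞) :=
  (NonUnitalStarAlgebra.adjoin ℂ (Set.range (universalIntegrated α))).topologicalClosure

instance instNonUnitalCStarAlgebraCrossedProduct (α : Circle →* (A ≃⋆ₐ[ℂ] A)) :
    NonUnitalCStarAlgebra (crossedProduct α) :=
  NonUnitalStarSubalgebra.nonUnitalCStarAlgebra (crossedProduct α)
    (h_closed := NonUnitalStarSubalgebra.isClosed_topologicalClosure _)

end CircleAction

end

/-!
Averaging over the circle gives a conditional expectation `E` of `A` onto `A^α`, and projecting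
Rokhlin unitaries to the spectral subspaces gives, in every degree `n`, elements `w` with `w* b w`
close to a given `b`. If `I` is an ideal of `A^α`, the elements `a` with `E(A a A) ⊆ I` form an
invariant ideal of `A`. It contains `I`: if `x` and `y` have degrees `n` and `-n`, then `E(x b y)`
is close to `(x w*) b (w y)` with `x w*` and `w y` in `A^α`. So `A^α` is simple as soon as `A` has
no invariant ideals.

In the crossed product, `p = ∫ v_ζ dζ` is a projection with `p a p = E(a) p`, so its corner is a
quotient of `A^α`; the GNS representation of an invariant state shows that `p ≠ 0`. The element
`a w* p w` is the function `ζ ↦ ζⁿ a w* w`, which is close to `ζ ↦ ζⁿ a`, so `p` generates the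
crossed product as an ideal, and simplicity passes from the corner to the whole algebra.
-/

noncomputable section

universe u

open MeasureTheory AddCircle

theorem fourier_eq_toCircle_zpow {T : ℝ} (n : ℤ) (t : AddCircle T) :
    fourier n t = (t.toCircle : ℂ) ^ n := by
  rw [fourier_apply, toCircle_zsmul, Circle.coe_zpow]

theorem toCircle_surjective {T : ℝ} (hT : T ≠ 0) :
    Function.Surjective (toCircle : AddCircle T → Circle) :=
  fun s => ((homeomorphCircle hT).surjective s).imp fun t ht => by
    rwa [homeomorphCircle_apply] at ht

theorem norm_fourier_smul {E : Type*} [NormedAddCommGroup E] [NormedSpace ℂ E] {T : ℝ} (n : ℤ)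
    (t : AddCircle T) (x : E) : ‖fourier n t • x‖ = ‖x‖ := by
  rw [norm_smul, fourier_apply, Circle.norm_coe, one_mul]

/-- A strongly continuous representation of the circle on `E` by linear isometries. -/
structure CircleRep (E : Type*) [NormedAddCommGroup E] [NormedSpace ℂ E] where
  toHom : Circle →* (E ≃ₗᵢ[ℂ] E)
  continuous_toHom : ∀ x, Continuous fun s => toHom s x

namespace CircleRep

variable {E : Type*} [NormedAddCommGroup E] [NormedSpace ℂ E]

/-- The elements `x` which are homogeneous of degree `n`: `s • x = sⁿ x` for every `s`. -/
def spectralSubspace (U : CircleRep E) (n : ℤ) : Submodule ℂ E where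
  carrier := {x | ∀ s : Circle, U.toHom s x = (s : ℂ) ^ n • x}
  add_mem' hx hy s := by rw [map_add, hx s, hy s, smul_add]
  zero_mem' s := by rw [map_zero, smul_zero]
  smul_mem' c x hx s := by rw [map_smul, hx s, smul_comm]

theorem mem_spectralSubspace {U : CircleRep E} {n : ℤ} {x : E} :
    x ∈ U.spectralSubspace n ↔ ∀ s : Circle, U.toHom s x = (s : ℂ) ^ n • x := Iff.rfl

variable (U : CircleRep E)

theorem toHom_toHom (s t : Circle) (x : E) : U.toHom s (U.toHom t x) = U.toHom (s * t) x := by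
  rw [map_mul]
  rfl

theorem continuous_orbit (x : E) :
    Continuous fun t : AddCircle (1 : ℝ) => U.toHom t.toCircle x :=
  (U.continuous_toHom x).comp AddCircle.continuous_toCircle

theorem integrable_fourier_smul (n : ℤ) (x : E) :
    Integrable (fun t : AddCircle (1 : ℝ) => fourier n t • U.toHom t.toCircle x) haarAddCircle :=
  ((map_continuous (fourier n)).smul (U.continuous_orbit x)).integrable_of_hasCompactSupport
    (HasCompactSupport.of_compactSpace _)

/-- The contractive projection onto the elements of degree `n`: the `n`-th Fourier coefficient of
the orbit map. -/
def fourierProj (n : ℤ) : E →L[ℂ] E :=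
  LinearMap.mkContinuous
    { toFun := fun x => ∫ t : AddCircle (1 : ℝ), fourier (-n) t • U.toHom t.toCircle x
        ∂haarAddCircle
      map_add' := fun x y => by
        simp only [map_add, smul_add]
        exact integral_add (U.integrable_fourier_smul _ x) (U.integrable_fourier_smul _ y)
      map_smul' := fun c x => by
        simp only [map_smul, RingHom.id_apply, smul_comm _ c]
        exact integral_smul c _ }
    1 fun x => by
      simpa using norm_integral_le_of_norm_le_const (μ := haarAddCircle (T := (1 : ℝ)))
        (Filter.Eventually.of_forall fun t =>
          ((norm_fourier_smul (-n) t _).trans ((U.toHom t.toCircle).norm_map x)).le)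

theorem fourierProj_apply (n : ℤ) (x : E) :
    U.fourierProj n x =
      ∫ t : AddCircle (1 : ℝ), fourier (-n) t • U.toHom t.toCircle x ∂haarAddCircle := rfl

theorem fourierProj_zero_apply (x : E) :
    U.fourierProj 0 x = ∫ t : AddCircle (1 : ℝ), U.toHom t.toCircle x ∂haarAddCircle := by
  simp only [fourierProj_apply, neg_zero, fourier_zero, one_smul]

theorem norm_fourierProj_apply_le (n : ℤ) (x : E) : ‖U.fourierProj n x‖ ≤ ‖x‖ := by
  simpa using (U.fourierProj n).le_of_opNorm_le
    (LinearMap.mkContinuous_norm_le _ zero_le_one _) x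

theorem fourierProj_toHom (n : ℤ) (s : Circle) (x : E) :
    U.fourierProj n (U.toHom s x) = (s : ℂ) ^ n • U.fourierProj n x := by
  obtain ⟨r, rfl⟩ := toCircle_surjective one_ne_zero s
  rw [fourierProj_apply, fourierProj_apply, ← integral_smul,
    ← integral_add_right_eq_self (fun t : AddCircle (1 : ℝ) =>
      (r.toCircle : ℂ) ^ n • fourier (-n) t • U.toHom t.toCircle x) r]
  refine integral_congr_ae (Filter.Eventually.of_forall fun t => ?_)
  simp only [fourier_eq_toCircle_zpow, toCircle_add, toHom_toHom, Circle.coe_mul, mul_zpow,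
    smul_smul]
  congr 1
  rw [mul_left_comm, ← zpow_add₀ (Circle.coe_ne_zero _), add_neg_cancel, zpow_zero, mul_one]

variable [CompleteSpace E]

theorem toHom_fourierProj (n : ℤ) (s : Circle) (x : E) :
    U.toHom s (U.fourierProj n x) = U.fourierProj n (U.toHom s x) := by
  calc U.toHom s (U.fourierProj n x)
      = ∫ t : AddCircle (1 : ℝ), U.toHom s (fourier (-n) t • U.toHom t.toCircle x)
          ∂haarAddCircle :=
        ((U.toHom s).toContinuousLinearEquiv.toContinuousLinearMap.integral_comp_comm
          (U.integrable_fourier_smul (-n) x)).symm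
    _ = U.fourierProj n (U.toHom s x) := by
        simp only [fourierProj_apply, map_smul, toHom_toHom, mul_comm s]

theorem fourierProj_mem_spectralSubspace (n : ℤ) (x : E) :
    U.fourierProj n x ∈ U.spectralSubspace n := fun s => by
  rw [toHom_fourierProj, fourierProj_toHom]

theorem fourierProj_of_mem_spectralSubspace {k : ℤ} {x : E} (hx : x ∈ U.spectralSubspace k)
    (n : ℤ) : U.fourierProj n x = if n = k then x else 0 := by
  have h : U.fourierProj n x = fourierCoeff (fourier (T := 1) k) n • x := by
    simp only [fourierProj_apply, fourierCoeff, ← integral_smul_const, smul_eq_mul, mul_smul,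
      fourier_eq_toCircle_zpow k, mem_spectralSubspace.mp hx]
  rw [h, fourierCoeff_fourier, Pi.single_apply, ite_smul, one_smul, zero_smul]

theorem norm_fourierProj_sub_le {n : ℤ} {x : E} {ε : ℝ}
    (hx : ∀ s : Circle, ‖U.toHom s x - (s : ℂ) ^ n • x‖ ≤ ε) : ‖U.fourierProj n x - x‖ ≤ ε := by
  have h : U.fourierProj n x - x = ∫ t : AddCircle (1 : ℝ),
      fourier (-n) t • (U.toHom t.toCircle x - (t.toCircle : ℂ) ^ n • x) ∂haarAddCircle := by
    have hphase (t : AddCircle (1 : ℝ)) : fourier (-n) t • (t.toCircle : ℂ) ^ n • x = x := by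
      rw [smul_smul, fourier_eq_toCircle_zpow, ← zpow_add₀ (Circle.coe_ne_zero _),
        neg_add_cancel, zpow_zero, one_smul]
    simp only [smul_sub, hphase]
    rw [integral_sub (U.integrable_fourier_smul _ _) (integrable_const _), fourierProj_apply]
    simp
  rw [h]
  simpa using norm_integral_le_of_norm_le_const (μ := haarAddCircle (T := (1 : ℝ)))
    (Filter.Eventually.of_forall fun t => (norm_fourier_smul (-n) t _).trans_le (hx t.toCircle))

theorem eq_zero_of_forall_apply_fourierProj_eq_zero (f : E →L[ℂ] ℂ) {x : E}
    (h : ∀ n, f (U.fourierProj n x) = 0) : f x = 0 := by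
  let g : C(AddCircle (1 : ℝ), ℂ) := ⟨fun t => f (U.toHom t.toCircle x),
    f.continuous.comp (U.continuous_orbit x)⟩
  have hg : fourierCoeff g = 0 := by
    ext n
    calc fourierCoeff g n = f (U.fourierProj n x) := by
          rw [fourierProj_apply, ← f.integral_comp_comm (U.integrable_fourier_smul _ _)]
          simp [fourierCoeff, g]
      _ = 0 := h n
  have hsum := has_pointwise_sum_fourier_series_of_summable (f := g)
    (by rw [hg]; exact summable_zero) 0
  simp only [hg, Pi.zero_apply, zero_smul] at hsum
  simpa [g] using hsum.unique hasSum_zero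

/-- By Hahn–Banach: a functional vanishing on `K` kills all Fourier coefficients of every orbit. -/
theorem eq_top_of_spectralSubspace_le {K : Submodule ℂ E} (hK : IsClosed (K : Set E))
    (h : ∀ n, U.spectralSubspace n ≤ K) : K = ⊤ := by
  refine (Submodule.eq_top_iff'.mpr fun x => by_contra fun hx => ?_)
  have hx' : K.mkQ x ≠ 0 := fun h0 => hx ((Submodule.Quotient.mk_eq_zero K).mp h0)
  obtain ⟨g, hg⟩ := SeparatingDual.exists_ne_zero (R := ℂ) hx'
  refine hg (U.eq_zero_of_forall_apply_fourierProj_eq_zero (g.comp K.mkQL) fun n => ?_)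
  have hn : K.mkQ (U.fourierProj n x) = 0 :=
    (Submodule.Quotient.mk_eq_zero K).mpr (h n (U.fourierProj_mem_spectralSubspace n x))
  exact (congrArg g hn).trans (map_zero g)

theorem map_mem_of_forall_spectralSubspace {F : Type*} [NormedAddCommGroup F] [NormedSpace ℂ F]
    (L : E →L[ℂ] F) {K : Submodule ℂ F} (hK : IsClosed (K : Set F))
    (h : ∀ n, ∀ x ∈ U.spectralSubspace n, L x ∈ K) (x : E) : L x ∈ K :=
  Submodule.eq_top_iff'.mp
    (U.eq_top_of_spectralSubspace_le (K := K.comap L.toLinearMap) (hK.preimage L.continuous) h) x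

section Translation

variable (F : Type*) [NormedAddCommGroup F] [NormedSpace ℂ F]

/-- The translation representation of the circle on `C(𝕋, F)`, `(s • f)(ζ) = f(ζ s)`. -/
def translation : CircleRep C(Circle, F) where
  toHom :=
    { toFun := fun s =>
        { toFun := fun f => f.comp (ContinuousMap.mulRight s)
          invFun := fun f => f.comp (ContinuousMap.mulRight s⁻¹)
          map_add' := fun _ _ => rfl
          map_smul' := fun _ _ => rfl
          left_inv := fun f => by ext ζ; simp
          right_inv := fun f => by ext ζ; simp
          norm_map' := fun f => by
            rw [ContinuousMap.norm_eq_iSup_norm, ContinuousMap.norm_eq_iSup_norm]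
            exact (Equiv.mulRight s).iSup_comp (g := fun ζ => ‖f ζ‖) }
      map_one' := by ext f ζ; simp
      map_mul' := fun s t => by ext f ζ; simp [mul_left_comm, mul_comm] }
  continuous_toHom f :=
    (ContinuousMap.curry ⟨fun p : Circle × Circle => f (p.2 * p.1), by fun_prop⟩).continuous

theorem translation_toHom_apply (s ζ : Circle) (f : C(Circle, F)) :
    (translation F).toHom s f ζ = f (ζ * s) := rfl

variable {F} in
theorem apply_of_mem_spectralSubspace_translation {n : ℤ} {f : C(Circle, F)}
    (hf : f ∈ (translation F).spectralSubspace n) (ζ : Circle) : f ζ = (ζ : ℂ) ^ n • f 1 := by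
  have h := DFunLike.congr_fun (hf ζ) 1
  rwa [translation_toHom_apply, one_mul] at h

end Translation

section InnerProductSpace

variable {H : Type*} [NormedAddCommGroup H] [InnerProductSpace ℂ H]

theorem inner_toHom_left (U : CircleRep H) (s : Circle) (ξ η : H) :
    inner ℂ (U.toHom s ξ) η = inner ℂ ξ (U.toHom s⁻¹ η) := by
  rw [← (U.toHom s).inner_map_map ξ, toHom_toHom, mul_inv_cancel, map_one]
  rfl

theorem star_fourierProj_zero [CompleteSpace H] (U : CircleRep H) :
    star (U.fourierProj 0) = U.fourierProj 0 := by
  have hint (ξ : H) : Integrable (fun t : AddCircle (1 : ℝ) => U.toHom t.toCircle ξ)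
      haarAddCircle := by
    simpa using U.integrable_fourier_smul 0 ξ
  refine (ContinuousLinearMap.eq_adjoint_iff _ _).mpr (fun ξ η => ?_) |>.symm
  calc inner ℂ (U.fourierProj 0 ξ) η
      = ∫ t : AddCircle (1 : ℝ), inner ℂ (U.toHom t.toCircle ξ) η ∂haarAddCircle := by
        rw [fourierProj_zero_apply, ← inner_conj_symm, ← integral_inner (hint ξ), ← integral_conj]
        simp only [inner_conj_symm]
    _ = ∫ t : AddCircle (1 : ℝ), inner ℂ ξ (U.toHom (-t).toCircle η) ∂haarAddCircle := by
        simp only [inner_toHom_left, toCircle_neg]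
    _ = inner ℂ ξ (U.fourierProj 0 η) := by
        rw [fourierProj_zero_apply, ← integral_inner (hint η),
          integral_neg_eq_self fun t : AddCircle (1 : ℝ) => inner ℂ ξ (U.toHom t.toCircle η)]

end InnerProductSpace

end CircleRep

section NormedStarGroup

variable {R : Type*} [NonUnitalNormedRing R] [StarRing R] [NormedStarGroup R]

theorem norm_star_conj_sub_star_conj_le {x y : R} (hx : ‖x‖ ≤ 1) (hy : ‖y‖ ≤ 1) (b : R) :
    ‖star y * b * y - star x * b * x‖ ≤ 2 * ‖b‖ * ‖y - x‖ := by
  have hsplit : star y * b * y - star x * b * x =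
      star y * b * (y - x) + star (y - x) * b * x := by
    rw [star_sub]; noncomm_ring
  calc ‖star y * b * y - star x * b * x‖
      ≤ ‖star y‖ * ‖b‖ * ‖y - x‖ + ‖star (y - x)‖ * ‖b‖ * ‖x‖ := by
        rw [hsplit]
        exact (norm_add_le _ _).trans (add_le_add norm_mul₃_le norm_mul₃_le)
    _ ≤ 1 * ‖b‖ * ‖y - x‖ + ‖y - x‖ * ‖b‖ * 1 := by
        rw [norm_star, norm_star]
        gcongr
    _ = 2 * ‖b‖ * ‖y - x‖ := by ring

theorem norm_star_conj_mul_sub_le {v w : R} (hw : ‖w‖ ≤ 1) (b : R) :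
    ‖star (v * w) * b * (v * w) - b‖ ≤ ‖star v * b * v - b‖ + ‖star w * b * w - b‖ := by
  have hsplit : star (v * w) * b * (v * w) - b =
      star w * (star v * b * v - b) * w + (star w * b * w - b) := by
    rw [star_mul]; noncomm_ring
  calc ‖star (v * w) * b * (v * w) - b‖
      ≤ ‖star w‖ * ‖star v * b * v - b‖ * ‖w‖ + ‖star w * b * w - b‖ := by
        rw [hsplit]
        exact (norm_add_le _ _).trans (by gcongr; exact norm_mul₃_le)
    _ ≤ 1 * ‖star v * b * v - b‖ * 1 + ‖star w * b * w - b‖ := by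
        rw [norm_star]
        gcongr
    _ = ‖star v * b * v - b‖ + ‖star w * b * w - b‖ := by ring

end NormedStarGroup

section CStarRing

variable {R : Type*} [NormedRing R] [StarRing R] [CStarRing R]

theorem norm_le_one_of_mem_unitary {u : R} (hu : u ∈ unitary R) : ‖u‖ ≤ 1 := by
  have h := CStarRing.norm_mem_unitary_mul (1 : R) hu
  rw [mul_one] at h
  rcases subsingleton_or_nontrivial R
  · rw [Subsingleton.elim u 0, norm_zero]; exact zero_le_one
  · rw [h, norm_one]

theorem norm_star_conj_sub_le_of_mem_unitary {u : R} (hu : u ∈ unitary R) (b : R) :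
    ‖star u * b * u - b‖ ≤ ‖u * b - b * u‖ := by
  have h : star u * b * u - b = - (star u * (u * b - b * u)) := by
    rw [mul_sub, ← mul_assoc, ← mul_assoc, Unitary.star_mul_self_of_mem hu, one_mul, neg_sub]
  rw [h, norm_neg, CStarRing.norm_mem_unitary_mul _ (Unitary.star_mem hu)]

theorem norm_conj_star_sub_le_of_mem_unitary {u : R} (hu : u ∈ unitary R) (b : R) :
    ‖u * b * star u - b‖ ≤ ‖u * b - b * u‖ := by
  have h : u * b * star u - b = (u * b - b * u) * star u := by
    rw [sub_mul, mul_assoc b, Unitary.mul_star_self_of_mem hu, mul_one]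
  rw [h, CStarRing.norm_mul_mem_unitary _ (Unitary.star_mem hu)]

end CStarRing

namespace CircleAction

variable {A : Type u} [CStarAlgebra A] {α : Circle →* (A ≃⋆ₐ[ℂ] A)}

section Grading

/-- A continuous circle action on a C*-algebra, as an isometric representation. -/
def IsContinuous.circleRep (hα : IsContinuous α) : CircleRep A where
  toHom :=
    { toFun := fun ζ => ⟨(α ζ).toAlgEquiv.toLinearEquiv, StarAlgEquiv.norm_map (α ζ)⟩
      map_one' := by ext; simp
      map_mul' := fun s t => by
        rw [map_mul]
        rfl }
  continuous_toHom := hα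

variable (hα : IsContinuous α)

theorem circleRep_toHom_apply (ζ : Circle) (a : A) : hα.circleRep.toHom ζ a = α ζ a := rfl

variable {hα}

theorem mem_spectralSubspace_iff {n : ℤ} {x : A} :
    x ∈ hα.circleRep.spectralSubspace n ↔ ∀ s : Circle, α s x = (s : ℂ) ^ n • x := Iff.rfl

theorem mem_spectralSubspace_zero_iff {a : A} :
    a ∈ hα.circleRep.spectralSubspace 0 ↔ a ∈ fixedPointAlgebra α := by
  simp only [mem_spectralSubspace_iff, zpow_zero, one_smul]
  rfl

theorem mul_mem_spectralSubspace {m n : ℤ} {x y : A} (hx : x ∈ hα.circleRep.spectralSubspace m)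
    (hy : y ∈ hα.circleRep.spectralSubspace n) :
    x * y ∈ hα.circleRep.spectralSubspace (m + n) := fun s => by
  rw [circleRep_toHom_apply, map_mul, mem_spectralSubspace_iff.mp hx,
    mem_spectralSubspace_iff.mp hy, smul_mul_smul_comm, zpow_add₀ (Circle.coe_ne_zero _)]

theorem star_mem_spectralSubspace {n : ℤ} {x : A} (hx : x ∈ hα.circleRep.spectralSubspace n) :
    star x ∈ hα.circleRep.spectralSubspace (-n) := fun s => by
  rw [circleRep_toHom_apply, map_star, mem_spectralSubspace_iff.mp hx, star_smul, star_zpow₀,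
    zpow_neg, ← inv_zpow, ← Circle.coe_inv, Circle.coe_inv_eq_conj, starRingEnd_apply]

end Grading

section Expectation

variable (hα : IsContinuous α)

/-- The conditional expectation `a ↦ ∫ α_ζ(a) dζ` of `A` onto the fixed point algebra. -/
def IsContinuous.expectation : A →L[ℂ] fixedPointAlgebra α :=
  (hα.circleRep.fourierProj 0).codRestrict (fixedPointAlgebra α).toSubalgebra.toSubmodule fun a =>
    mem_spectralSubspace_zero_iff.mp (hα.circleRep.fourierProj_mem_spectralSubspace 0 a)

theorem coe_expectation (a : A) : (hα.expectation a : A) = hα.circleRep.fourierProj 0 a := rfl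

theorem expectation_coe (a : fixedPointAlgebra α) : hα.expectation a = a :=
  Subtype.ext <| by
    rw [coe_expectation, hα.circleRep.fourierProj_of_mem_spectralSubspace
      (mem_spectralSubspace_zero_iff.mpr a.2), if_pos rfl]

theorem expectation_one : hα.expectation 1 = 1 := expectation_coe hα 1

theorem expectation_apply (s : Circle) (a : A) : hα.expectation (α s a) = hα.expectation a :=
  Subtype.ext <| by
    rw [coe_expectation, coe_expectation, ← circleRep_toHom_apply hα, CircleRep.fourierProj_toHom,
      zpow_zero, one_smul]

theorem expectation_of_mem_spectralSubspace {n : ℤ} (hn : n ≠ 0) {a : A}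
    (ha : a ∈ hα.circleRep.spectralSubspace n) : hα.expectation a = 0 :=
  Subtype.ext <| by
    rw [coe_expectation, hα.circleRep.fourierProj_of_mem_spectralSubspace ha, if_neg hn.symm]
    rfl

end Expectation

section Rokhlin

/-- Project a Rokhlin unitary to the spectral subspace of degree one. -/
theorem RokhlinProperty.exists_mem_spectralSubspace_one (hR : RokhlinProperty α)
    (hα : IsContinuous α) (b : A) {ε : ℝ} (hε : 0 < ε) :
    ∃ w ∈ hα.circleRep.spectralSubspace 1, ‖w‖ ≤ 1 ∧
      ‖star w * b * w - b‖ < ε ∧ ‖w * b * star w - b‖ < ε := by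
  set δ := ε / (2 * ‖b‖ + 1) with hδ
  have hδ_eq : 2 * ‖b‖ * δ + δ = ε := by rw [hδ]; field_simp
  obtain ⟨u, hu, hu_eigen, hu_comm⟩ := hR δ (by positivity) {b}
  have hu_norm : ‖u‖ ≤ 1 := norm_le_one_of_mem_unitary hu
  have hub : ‖u * b - b * u‖ < δ := hu_comm b (Finset.mem_singleton_self b)
  set w := hα.circleRep.fourierProj 1 u
  have hw_norm : ‖w‖ ≤ 1 := (hα.circleRep.norm_fourierProj_apply_le 1 u).trans hu_norm
  have hwu : ‖w - u‖ ≤ δ := hα.circleRep.norm_fourierProj_sub_le fun s => by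
    simpa only [zpow_one, circleRep_toHom_apply] using (hu_eigen s).le
  have hwu' : 2 * ‖b‖ * ‖w - u‖ ≤ 2 * ‖b‖ * δ := by gcongr
  refine ⟨w, hα.circleRep.fourierProj_mem_spectralSubspace 1 u, hw_norm, ?_, ?_⟩
  · have hwb := norm_star_conj_sub_star_conj_le hu_norm hw_norm b
    have hub' := norm_star_conj_sub_le_of_mem_unitary hu b
    linarith [norm_sub_le_norm_sub_add_norm_sub (star w * b * w) (star u * b * u) b]
  · have hwb := norm_star_conj_sub_star_conj_le (x := star u) (y := star w)
      (by rwa [norm_star]) (by rwa [norm_star]) b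
    rw [← star_sub, norm_star, star_star, star_star] at hwb
    have hub' := norm_conj_star_sub_le_of_mem_unitary hu b
    linarith [norm_sub_le_norm_sub_add_norm_sub (w * b * star w) (u * b * star u) b]

theorem RokhlinProperty.exists_mem_spectralSubspace (hR : RokhlinProperty α)
    (hα : IsContinuous α) (b : A) (n : ℤ) {ε : ℝ} (hε : 0 < ε) :
    ∃ w ∈ hα.circleRep.spectralSubspace n, ‖star w * b * w - b‖ < ε := by
  induction n using Int.induction_on generalizing ε with
  | zero => exact ⟨1, mem_spectralSubspace_zero_iff.mpr (one_mem _), by simpa⟩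
  | succ n ih =>
    obtain ⟨v, hv, hvb⟩ := ih (half_pos hε)
    obtain ⟨w, hw, hw_norm, hwb, -⟩ := hR.exists_mem_spectralSubspace_one hα b (half_pos hε)
    exact ⟨v * w, mul_mem_spectralSubspace hv hw,
      (norm_star_conj_mul_sub_le hw_norm b).trans_lt (by linarith)⟩
  | pred n ih =>
    obtain ⟨v, hv, hvb⟩ := ih (half_pos hε)
    obtain ⟨w, hw, hw_norm, -, hwb⟩ := hR.exists_mem_spectralSubspace_one hα b (half_pos hε)
    refine ⟨v * star w, mul_mem_spectralSubspace hv (star_mem_spectralSubspace hw),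
      (norm_star_conj_mul_sub_le (by rwa [norm_star]) b).trans_lt ?_⟩
    rw [star_star]
    linarith

theorem RokhlinProperty.mem_closure_star_conj (hR : RokhlinProperty α) (hα : IsContinuous α)
    (b : A) (n : ℤ) :
    b ∈ closure ((fun w => star w * b * w) '' (hα.circleRep.spectralSubspace n : Set A)) :=
  Metric.mem_closure_iff.mpr fun _ hε =>
    let ⟨w, hw, hwb⟩ := hR.exists_mem_spectralSubspace hα b n hε
    ⟨_, Set.mem_image_of_mem _ hw, by rwa [dist_comm, dist_eq_norm]⟩

end Rokhlin

/-- `A` is `α`-simple: it is nonzero and has no closed two-sided ideals besides zero and itself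
which are invariant under the action `α`. -/
def IsActionSimple (α : Circle →* (A ≃⋆ₐ[ℂ] A)) : Prop :=
  Nontrivial A ∧ ∀ I : TwoSidedIdeal A, IsClosed (I : Set A) →
    (∀ ζ : Circle, ∀ a ∈ I, α ζ a ∈ I) → I = ⊥ ∨ I = ⊤

theorem isActionSimple_of_isSimpleCStarAlgebra (hA : IsSimpleCStarAlgebra A)
    (α : Circle →* (A ≃⋆ₐ[ℂ] A)) : IsActionSimple α :=
  ⟨hA.1, fun I hI _ => hA.2 I hI⟩

section ExpectationIdeal

variable (hα : IsContinuous α) (I : TwoSidedIdeal (fixedPointAlgebra α))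

/-- The largest ideal of `A` whose image under the conditional expectation is contained in the
ideal `I` of the fixed point algebra. -/
def expectationIdeal : TwoSidedIdeal A :=
  .mk' {a | ∀ x y, hα.expectation (x * a * y) ∈ I}
    (fun x y => by rw [mul_zero, zero_mul, map_zero]; exact I.zero_mem)
    (fun ha hb x y => by rw [mul_add, add_mul, map_add]; exact I.add_mem (ha x y) (hb x y))
    (fun ha x y => by rw [mul_neg, neg_mul, map_neg]; exact I.neg_mem (ha x y))
    (fun {c _} ha x y => by rw [← mul_assoc]; exact ha (x * c) y)
    (fun {_ c} ha x y => by rw [← mul_assoc, mul_assoc _ c]; exact ha x (c * y))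

variable {hα I}

theorem mem_expectationIdeal {a : A} :
    a ∈ expectationIdeal hα I ↔ ∀ x y, hα.expectation (x * a * y) ∈ I :=
  TwoSidedIdeal.mem_mk' ..

theorem isClosed_expectationIdeal (hI : IsClosed (I : Set (fixedPointAlgebra α))) :
    IsClosed (expectationIdeal hα I : Set A) := by
  have h : (expectationIdeal hα I : Set A) =
      ⋂ (x) (y), {a | hα.expectation (x * a * y) ∈ (I : Set (fixedPointAlgebra α))} := by
    ext a
    simp only [Set.mem_iInter]
    exact mem_expectationIdeal
  rw [h]
  exact isClosed_iInter fun x => isClosed_iInter fun y =>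
    hI.preimage (hα.expectation.continuous.comp (by fun_prop))

theorem map_mem_expectationIdeal (ζ : Circle) {a : A} (ha : a ∈ expectationIdeal hα I) :
    α ζ a ∈ expectationIdeal hα I :=
  mem_expectationIdeal.mpr fun x y => by
    have hinv (z : A) : α ζ (α ζ⁻¹ z) = z := by
      rw [map_inv]
      exact (α ζ).apply_symm_apply z
    have h := mem_expectationIdeal.mp ha (α ζ⁻¹ x) (α ζ⁻¹ y)
    rwa [← expectation_apply hα ζ, map_mul (α ζ), map_mul (α ζ), hinv, hinv] at h

/-- If `x` and `y` have degrees `m` and `n`, then `E(x b y)` vanishes unless `m + n = 0`, and then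
`x b y` is approximated by `(x w*) b (w y)` with `w` of degree `m`, where `x w*` and `w y` are fixed
points. -/
theorem expectation_mul_mul_mem_of_mem_spectralSubspace (hR : RokhlinProperty α)
    (hI : IsClosed (I : Set (fixedPointAlgebra α))) {b : fixedPointAlgebra α} (hb : b ∈ I)
    {m n : ℤ} {x y : A} (hx : x ∈ hα.circleRep.spectralSubspace m)
    (hy : y ∈ hα.circleRep.spectralSubspace n) : hα.expectation (x * b * y) ∈ I := by
  have hxb : x * b ∈ hα.circleRep.spectralSubspace m := by
    simpa only [add_zero] using mul_mem_spectralSubspace hx (mem_spectralSubspace_zero_iff.mpr b.2)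
  by_cases hmn : m + n = 0
  swap
  · rw [expectation_of_mem_spectralSubspace hα hmn (mul_mem_spectralSubspace hxb hy)]
    exact I.zero_mem
  have happrox := hR.mem_closure_star_conj hα (b : A) m
  refine hI.closure_subset (map_mem_closure (f := fun c => hα.expectation (x * c * y))
    (hα.expectation.continuous.comp (by fun_prop)) happrox ?_)
  rintro _ ⟨w, hw, rfl⟩
  have hxw : x * star w ∈ fixedPointAlgebra α := mem_spectralSubspace_zero_iff.mp <| by
    simpa only [add_neg_cancel] using mul_mem_spectralSubspace hx (star_mem_spectralSubspace hw)
  have hwy : w * y ∈ fixedPointAlgebra α := mem_spectralSubspace_zero_iff.mp <| by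
    simpa only [hmn] using mul_mem_spectralSubspace hw hy
  have heq : x * (star w * b * w) * y =
      ((⟨x * star w, hxw⟩ * b * ⟨w * y, hwy⟩ : fixedPointAlgebra α) : A) := by
    simp only [MulMemClass.coe_mul, mul_assoc]
  change hα.expectation (x * (star w * b * w) * y) ∈ I
  rw [heq, expectation_coe]
  exact I.mul_mem_right _ _ (I.mul_mem_left _ _ hb)

theorem coe_mem_expectationIdeal (hR : RokhlinProperty α)
    (hI : IsClosed (I : Set (fixedPointAlgebra α))) {b : fixedPointAlgebra α} (hb : b ∈ I) :
    (b : A) ∈ expectationIdeal hα I := by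
  let K : Submodule ℂ (fixedPointAlgebra α) := I.asIdeal.restrictScalars ℂ
  have hK : IsClosed (K : Set (fixedPointAlgebra α)) := hI
  refine mem_expectationIdeal.mpr fun x y => ?_
  refine hα.circleRep.map_mem_of_forall_spectralSubspace (K := K)
    (hα.expectation.comp (ContinuousLinearMap.mul ℂ A (x * b))) hK (fun n y hy => ?_) y
  exact hα.circleRep.map_mem_of_forall_spectralSubspace (K := K)
    (hα.expectation.comp ((ContinuousLinearMap.mul ℂ A).flip y ∘L
      (ContinuousLinearMap.mul ℂ A).flip b)) hK
    (fun m x hx => expectation_mul_mul_mem_of_mem_spectralSubspace hR hI hb hx hy) x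

end ExpectationIdeal

theorem isSimpleCStarAlgebra_fixedPointAlgebra (hA : IsActionSimple α) (hα : IsContinuous α)
    (hR : RokhlinProperty α) : IsSimpleCStarAlgebra (fixedPointAlgebra α) := by
  have := hA.1
  refine ⟨⟨1, 0, fun h => one_ne_zero (congrArg Subtype.val h : (1 : A) = 0)⟩, fun I hI => ?_⟩
  refine (hA.2 (expectationIdeal hα I) (isClosed_expectationIdeal hI)
    fun ζ _ => map_mem_expectationIdeal ζ).imp (fun hbot => ?_) (fun htop => ?_)
  · refine eq_bot_iff.mpr fun b hb => Subtype.ext ?_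
    have hbJ := coe_mem_expectationIdeal (hα := hα) hR hI hb
    rwa [hbot, TwoSidedIdeal.mem_bot] at hbJ
  · have h1 : (1 : A) ∈ expectationIdeal hα I := by rw [htop]; trivial
    have h2 := mem_expectationIdeal.mp h1 1 1
    rw [one_mul, one_mul, expectation_one] at h2
    exact (TwoSidedIdeal.one_mem_iff I).mp h2

end CircleAction

theorem toSubmodule_adjoin_eq_span {R B : Type*} [CommSemiring R] [StarRing R]
    [NonUnitalSemiring B] [StarRing B] [Module R B] [StarModule R B] [IsScalarTower R B B]
    [SMulCommClass R B B] {S : Set B} (hmul : ∀ x ∈ S, ∀ y ∈ S, x * y ∈ S)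
    (hstar : ∀ x ∈ S, star x ∈ S) :
    (NonUnitalStarAlgebra.adjoin R S).toSubmodule = Submodule.span R S := by
  have hS : S ∪ star S = S := Set.union_eq_left.mpr fun x hx => by
    simpa only [star_star] using hstar _ hx
  have hclosure : (Subsemigroup.closure S : Set B) = S :=
    congrArg _ (Subsemigroup.closure_eq ⟨S, fun {x y} hx hy => hmul x hx y hy⟩)
  rw [NonUnitalStarAlgebra.adjoin_eq_span, hS, hclosure]

theorem closure_adjoin_subset_closure_span {R B : Type*} [CommSemiring R] [StarRing R]
    [NonUnitalSemiring B] [StarRing B] [Module R B] [StarModule R B] [IsScalarTower R B B]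
    [SMulCommClass R B B] [TopologicalSpace B] [IsTopologicalSemiring B] [ContinuousStar B]
    [ContinuousConstSMul R B] {S U : Set B} (hmul : ∀ x ∈ S, ∀ y ∈ S, x * y ∈ S)
    (hstar : ∀ x ∈ S, star x ∈ S) (hU : U ⊆ closure (Submodule.span R S : Set B)) :
    closure (NonUnitalStarAlgebra.adjoin R U : Set B) ⊆ closure (Submodule.span R S : Set B) := by
  rw [← toSubmodule_adjoin_eq_span hmul hstar] at hU ⊢
  refine closure_minimal ?_ isClosed_closure
  exact NonUnitalStarAlgebra.adjoin_le
    (S := (NonUnitalStarAlgebra.adjoin R S).topologicalClosure) hU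

section TwoSidedIdeal

variable {R : Type*} [NonUnitalRing R]

/-- The right annihilator of a two-sided ideal, which is again a two-sided ideal. -/
def rightAnnihilator (I : TwoSidedIdeal R) : TwoSidedIdeal R :=
  .mk' {c | ∀ x ∈ I, x * c = 0}
    (fun x _ => mul_zero x)
    (fun ha hb x hx => by rw [mul_add, ha x hx, hb x hx, add_zero])
    (fun ha x hx => by rw [mul_neg, ha x hx, neg_zero])
    (fun ha x hx => by rw [← mul_assoc, ha _ (I.mul_mem_right _ _ hx)])
    (fun ha x hx => by rw [← mul_assoc, ha x hx, zero_mul])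

theorem mem_rightAnnihilator {I : TwoSidedIdeal R} {c : R} :
    c ∈ rightAnnihilator I ↔ ∀ x ∈ I, x * c = 0 :=
  TwoSidedIdeal.mem_mk' ..

theorem isClosed_rightAnnihilator [TopologicalSpace R] [T1Space R] [ContinuousMul R]
    (I : TwoSidedIdeal R) : IsClosed (rightAnnihilator I : Set R) := by
  have h : (rightAnnihilator I : Set R) = ⋂ x ∈ I, {c | x * c = 0} := by
    ext c
    simp only [Set.mem_iInter]
    exact mem_rightAnnihilator
  rw [h]
  exact isClosed_biInter fun x _ => isClosed_singleton.preimage (continuous_const_mul x)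

theorem eq_bot_of_rightAnnihilator_eq_top {R : Type*} [NonUnitalNormedRing R] [StarRing R]
    [CStarRing R] {I : TwoSidedIdeal R} (h : rightAnnihilator I = ⊤) : I = ⊥ :=
  eq_bot_iff.mpr fun x hx => by
    have hstar : star x ∈ rightAnnihilator I := by rw [h]; trivial
    exact CStarRing.mul_star_self_eq_zero_iff x |>.mp (mem_rightAnnihilator.mp hstar x hx)

theorem isClosed_comap {R S F : Type*} [NonUnitalRing R] [TopologicalSpace R] [NonUnitalRing S]
    [TopologicalSpace S] [FunLike F R S] [NonUnitalRingHomClass F R S] {φ : F} (hφ : Continuous φ)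
    {I : TwoSidedIdeal S} (hI : IsClosed (I : Set S)) : IsClosed (I.comap φ : Set R) := by
  have h : (I.comap φ : Set R) = φ ⁻¹' I := Set.ext fun _ => TwoSidedIdeal.mem_comap φ
  rw [h]
  exact hI.preimage hφ

end TwoSidedIdeal

section SimpleCStarAlgebra

variable {B : Type*} [NonUnitalCStarAlgebra B]

theorem smul_mem_of_isClosed_twoSidedIdeal {I : TwoSidedIdeal B} (hI : IsClosed (I : Set B))
    (c : ℂ) {x : B} (hx : x ∈ I) : c • x ∈ I := by
  let _ := CStarAlgebra.spectralOrder B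
  let _ := CStarAlgebra.spectralOrderedRing B
  have hunit := CStarAlgebra.increasingApproximateUnit B
  have := hunit.neBot
  have hlim : Filter.Tendsto (fun e => c • x * e) (CStarAlgebra.approximateUnit B)
      (nhds (c • x)) := hunit.tendsto_mul_left (c • x)
  refine hI.mem_of_tendsto hlim (Filter.Eventually.of_forall fun e => ?_)
  rw [smul_mul_assoc, ← mul_smul_comm]
  exact I.mul_mem_right _ _ hx

/-- A closed two-sided ideal of a C*-algebra, as a complex subspace. -/
def submoduleOfIsClosed (I : TwoSidedIdeal B) (hI : IsClosed (I : Set B)) : Submodule ℂ B where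
  carrier := I
  add_mem' := I.add_mem
  zero_mem' := I.zero_mem
  smul_mem' c _ := smul_mem_of_isClosed_twoSidedIdeal hI c

section Hom

open scoped CStarAlgebra

variable {S : Type*} [CStarAlgebra S] {φ : S →⋆ₙₐ[ℂ] B}

theorem isometry_of_isSimpleCStarAlgebra (hS : IsSimpleCStarAlgebra S) (hφ : φ 1 ≠ 0) :
    Isometry φ := by
  have hmem {s : S} : s ∈ (⊥ : TwoSidedIdeal B).comap φ ↔ φ s = 0 :=
    (TwoSidedIdeal.mem_comap φ).trans (TwoSidedIdeal.mem_bot B)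
  refine NonUnitalStarAlgHom.isometry φ ((injective_iff_map_eq_zero φ).mpr fun s hs => ?_)
  rcases hS.2 ((⊥ : TwoSidedIdeal B).comap φ) (isClosed_comap (map_continuous φ)
    isClosed_singleton) with hbot | htop
  · exact (TwoSidedIdeal.mem_bot S).mp (hbot ▸ hmem.mpr hs)
  · exact absurd (hmem.mp (by rw [htop]; trivial)) hφ

theorem mul_mul_mem_range_of_dense (hS : IsSimpleCStarAlgebra S) (hφ : φ 1 ≠ 0) {X : Set B}
    (hX : Dense (Submodule.span ℂ X : Set B)) (hcorner : ∀ x ∈ X, φ 1 * x * φ 1 ∈ Set.range φ)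
    (y : B) : φ 1 * y * φ 1 ∈ Set.range φ := by
  let K : Submodule ℂ B :=
    { carrier := {y | φ 1 * y * φ 1 ∈ Set.range φ}
      zero_mem' := ⟨0, by rw [map_zero, mul_zero, zero_mul]⟩
      add_mem' := by
        rintro x y ⟨a, ha⟩ ⟨b, hb⟩
        exact ⟨a + b, by rw [map_add, ha, hb, mul_add, add_mul]⟩
      smul_mem' := by
        rintro c x ⟨a, ha⟩
        exact ⟨c • a, by rw [map_smul, ha, mul_smul_comm, smul_mul_assoc]⟩ }
  have hK : IsClosed (K : Set B) :=
    (isometry_of_isSimpleCStarAlgebra hS hφ).isClosedEmbedding.isClosed_range.preimage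
      (by fun_prop : Continuous fun y => φ 1 * y * φ 1)
  have hspan : Submodule.span ℂ X ≤ K := Submodule.span_le.mpr hcorner
  exact closure_minimal hspan hK (hX y)

theorem eq_top_of_dense {p : B} {X : Set B} (hX : Dense (Submodule.span ℂ X : Set B))
    (hfull : ∀ x ∈ X, ∃ a b, x = a * p * b) {I : TwoSidedIdeal B} (hI : IsClosed (I : Set B))
    (hp : p ∈ I) : I = ⊤ := by
  have hspan : Submodule.span ℂ X ≤ submoduleOfIsClosed I hI := by
    refine Submodule.span_le.mpr fun x hx => ?_
    obtain ⟨a, b, rfl⟩ := hfull x hx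
    exact I.mul_mem_right _ _ (I.mul_mem_left _ _ hp)
  exact eq_top_iff.mpr fun x _ => closure_minimal hspan hI (hX x)

/-- A nonzero closed ideal meets the corner `φ 1 * B * φ 1`, for otherwise `φ 1` would be in its
annihilator; so it contains the image of the simple algebra `S`. -/
theorem isSimpleCStarAlgebra_of_dense (hS : IsSimpleCStarAlgebra S) (hφ : φ 1 ≠ 0) {X : Set B}
    (hX : Dense (Submodule.span ℂ X : Set B)) (hcorner : ∀ x ∈ X, φ 1 * x * φ 1 ∈ Set.range φ)
    (hfull : ∀ x ∈ X, ∃ a b, x = a * φ 1 * b) : IsSimpleCStarAlgebra B := by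
  refine ⟨⟨φ 1, 0, hφ⟩, fun I hI => ?_⟩
  refine (hS.2 (I.comap φ) (isClosed_comap (map_continuous φ) hI)).imp
    (fun hbot => ?_) (fun htop => ?_)
  swap
  · have h1 : (1 : S) ∈ I.comap φ := by rw [htop]; trivial
    exact eq_top_of_dense hX hfull hI ((TwoSidedIdeal.mem_comap φ).mp h1)
  have hcomp {y : B} (hy : y ∈ I) : φ 1 * y * φ 1 = 0 := by
    obtain ⟨s, hs⟩ := mul_mul_mem_range_of_dense hS hφ hX hcorner y
    have hs_mem : s ∈ I.comap φ := (TwoSidedIdeal.mem_comap φ).mpr <| by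
      rw [hs]
      exact I.mul_mem_right _ _ (I.mul_mem_left _ _ hy)
    rw [hbot, TwoSidedIdeal.mem_bot] at hs_mem
    rw [← hs, hs_mem, map_zero]
  have hann : φ 1 ∈ rightAnnihilator I := mem_rightAnnihilator.mpr fun x hx => by
    refine (CStarRing.star_mul_self_eq_zero_iff _).mp ?_
    rw [star_mul, ← map_star, star_one, mul_assoc, ← mul_assoc (star x), ← mul_assoc]
    exact hcomp (I.mul_mem_left _ _ hx)
  exact eq_bot_of_rightAnnihilator_eq_top
    (eq_top_of_dense hX hfull (isClosed_rightAnnihilator I) hann)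

end Hom

end SimpleCStarAlgebra

namespace CircleAction

variable {A : Type u} [CStarAlgebra A] {α : Circle →* (A ≃⋆ₐ[ℂ] A)}

/-- The function `ζ ↦ a * α_ζ(b)`. In the crossed product it represents `a * p * b`, where `p` is
the projection which is the integral of the canonical unitaries over the circle. -/
def IsContinuous.orbitFunction (hα : IsContinuous α) (a b : A) : C(Circle, A) where
  toFun ζ := a * α ζ b
  continuous_toFun := continuous_const.mul (hα b)

theorem orbitFunction_apply (hα : IsContinuous α) (a b : A) (ζ : Circle) :
    hα.orbitFunction a b ζ = a * α ζ b := rfl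

theorem orbitFunction_mul_of_mem (hα : IsContinuous α) {c : A} (hc : c ∈ fixedPointAlgebra α)
    (a b : A) : hα.orbitFunction (a * c) b = hα.orbitFunction a (c * b) := by
  ext ζ
  rw [orbitFunction_apply, orbitFunction_apply, map_mul, hc, mul_assoc]

namespace CovariantRep

variable (ρ : CovariantRep α)

theorem integrated_apply (f : C(Circle, A)) (ξ : ρ.H) :
    ρ.integrated f ξ = ∫ t : AddCircle (1 : ℝ),
      ρ.π (f t.toCircle) ((ρ.v t.toCircle : ρ.H →L[ℂ] ρ.H) ξ) ∂haarAddCircle := rfl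

theorem integrated_add (f g : C(Circle, A)) :
    ρ.integrated (f + g) = ρ.integrated f + ρ.integrated g := by
  ext ξ
  simp only [integrated_apply, ContinuousMap.add_apply, map_add, add_apply]
  exact integral_add (ρ.integrable_integrand f ξ) (ρ.integrable_integrand g ξ)

theorem integrated_smul (c : ℂ) (f : C(Circle, A)) :
    ρ.integrated (c • f) = c • ρ.integrated f := by
  ext ξ
  simp only [integrated_apply, ContinuousMap.smul_apply, map_smul, smul_apply]
  exact integral_smul c _

/-- The circle representation `v` of a covariant representation `(π, v)`. -/
def circleRep : CircleRep ρ.H where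
  toHom := Unitary.linearIsometryEquiv.toMonoidHom.comp ρ.v
  continuous_toHom := ρ.continuous_v

theorem circleRep_toHom_apply (s : Circle) (ξ : ρ.H) :
    ρ.circleRep.toHom s ξ = (ρ.v s : ρ.H →L[ℂ] ρ.H) ξ := rfl

theorem v_apply_π_apply (s : Circle) (a : A) (ξ : ρ.H) :
    (ρ.v s : ρ.H →L[ℂ] ρ.H) (ρ.π a ξ) = ρ.π (α s a) ((ρ.v s : ρ.H →L[ℂ] ρ.H) ξ) := by
  have h : (ρ.v s : ρ.H →L[ℂ] ρ.H) * ρ.π a = ρ.π (α s a) * (ρ.v s : ρ.H →L[ℂ] ρ.H) := by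
    rw [← ρ.covariant, mul_assoc _ (star _), Unitary.coe_star_mul_self, mul_one]
  exact congrArg (fun T : ρ.H →L[ℂ] ρ.H => T ξ) h

theorem integrated_orbitFunction (hα : IsContinuous α) (a b : A) :
    ρ.integrated (hα.orbitFunction a b) = ρ.π a * ρ.circleRep.fourierProj 0 * ρ.π b := by
  ext ξ
  calc ρ.integrated (hα.orbitFunction a b) ξ
      = ∫ t : AddCircle (1 : ℝ), ρ.π a (ρ.circleRep.toHom t.toCircle (ρ.π b ξ))
          ∂haarAddCircle := by
        simp only [integrated_apply, orbitFunction_apply, map_mul, circleRep_toHom_apply,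
          v_apply_π_apply]
        rfl
    _ = ρ.π a (ρ.circleRep.fourierProj 0 (ρ.π b ξ)) := by
        rw [CircleRep.fourierProj_zero_apply]
        exact (ρ.π a).integral_comp_comm (by
          simpa using ρ.circleRep.integrable_fourier_smul 0 (ρ.π b ξ))

open scoped CStarAlgebra in
theorem fourierProj_mul_π_mul_fourierProj (hα : IsContinuous α) (a : A) :
    ρ.circleRep.fourierProj 0 * ρ.π a * ρ.circleRep.fourierProj 0 =
      ρ.π (hα.expectation a) * ρ.circleRep.fourierProj 0 := by
  ext ξ
  set η := ρ.circleRep.fourierProj 0 ξ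
  have hfixed (s : Circle) : (ρ.v s : ρ.H →L[ℂ] ρ.H) η = η := by
    have h := ρ.circleRep.fourierProj_mem_spectralSubspace 0 ξ s
    rwa [zpow_zero, one_smul] at h
  let πη : A →L[ℂ] ρ.H :=
    (ContinuousLinearMap.apply ℂ ρ.H η).comp ⟨ρ.π.toAlgHom.toLinearMap, map_continuous ρ.π⟩
  calc ρ.circleRep.fourierProj 0 (ρ.π a η)
      = ∫ t : AddCircle (1 : ℝ), πη (hα.circleRep.toHom t.toCircle a) ∂haarAddCircle := by
        simp only [CircleRep.fourierProj_zero_apply, circleRep_toHom_apply, v_apply_π_apply, hfixed]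
        rfl
    _ = πη (hα.expectation a) := by
        rw [coe_expectation, CircleRep.fourierProj_zero_apply]
        exact πη.integral_comp_comm (by simpa using hα.circleRep.integrable_fourier_smul 0 a)

end CovariantRep

/-- If `w` has degree `n` and `w* w` is close to `1`, then the orbit function `ζ ↦ a w* α_ζ(w)` is
close to `ζ ↦ ζⁿ a`. -/
theorem mem_of_mem_spectralSubspace_translation (hα : IsContinuous α) (hR : RokhlinProperty α)
    {K : Submodule ℂ C(Circle, A)} (hK : IsClosed (K : Set C(Circle, A)))
    (hmem : ∀ a b, hα.orbitFunction a b ∈ K) {n : ℤ} {f : C(Circle, A)}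
    (hf : f ∈ (CircleRep.translation A).spectralSubspace n) : f ∈ K := by
  have hmonomial (c : A) (ζ : Circle) : ‖((ζ : ℂ) ^ n) • c‖ = ‖c‖ := by
    rw [norm_smul, norm_zpow, Circle.norm_coe, one_zpow, one_mul]
  refine hK.closure_subset (Metric.mem_closure_iff.mpr fun ε hε => ?_)
  obtain ⟨w, hw, hw_near⟩ := hR.exists_mem_spectralSubspace hα 1 n
    (div_pos hε (by positivity : 0 < ‖f 1‖ + 1))
  rw [mul_one] at hw_near
  refine ⟨hα.orbitFunction (f 1 * star w) w, hmem _ _, ?_⟩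
  have hbound : ‖f 1‖ * ‖star w * w - 1‖ < ε :=
    calc ‖f 1‖ * ‖star w * w - 1‖ ≤ (‖f 1‖ + 1) * ‖star w * w - 1‖ := by gcongr; linarith
      _ < ε := (lt_div_iff₀' (by positivity)).mp hw_near
  rw [dist_comm, dist_eq_norm]
  refine ((ContinuousMap.norm_le _ (by positivity)).mpr fun ζ => ?_).trans_lt hbound
  rw [ContinuousMap.sub_apply, orbitFunction_apply, mem_spectralSubspace_iff.mp hw,
    CircleRep.apply_of_mem_spectralSubspace_translation hf ζ, mul_smul_comm, ← smul_sub, hmonomial,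
    mul_assoc]
  simpa only [mul_sub, mul_one] using norm_mul_le (f 1) (star w * w - 1)

theorem eq_top_of_forall_orbitFunction_mem (hα : IsContinuous α) (hR : RokhlinProperty α)
    {K : Submodule ℂ C(Circle, A)} (hK : IsClosed (K : Set C(Circle, A)))
    (hmem : ∀ a b, hα.orbitFunction a b ∈ K) : K = ⊤ :=
  (CircleRep.translation A).eq_top_of_spectralSubspace_le hK fun _ _ =>
    mem_of_mem_spectralSubspace_translation hα hR hK hmem

section CrossedProduct

/-- The bounded families of operators indexed by the covariant representations: the C*-algebra in
which the crossed product is generated. -/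
abbrev RepProduct (α : Circle →* (A ≃⋆ₐ[ℂ] A)) : Type (u + 1) :=
  lp (fun ρ : CovariantRep α => ρ.H →L[ℂ] ρ.H) ∞

/-- The universal integrated form as a continuous linear map. -/
def universalIntegratedCLM (α : Circle →* (A ≃⋆ₐ[ℂ] A)) : C(Circle, A) →L[ℂ] RepProduct α :=
  LinearMap.mkContinuous
    { toFun := universalIntegrated α
      map_add' := fun f g => by
        ext ρ : 2
        exact ρ.integrated_add f g
      map_smul' := fun c f => by
        ext ρ : 2
        exact ρ.integrated_smul c f }
    1 fun f => by
      rw [one_mul]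
      exact lp.norm_le_of_forall_le (norm_nonneg f) fun ρ => ρ.norm_integrated_le f

variable (hα : IsContinuous α)

/-- The element `a * p * b` of the crossed product, where `p` is the projection which is the
integral of the canonical unitaries over the circle. -/
def IsContinuous.sandwich (a b : A) : crossedProduct α :=
  ⟨universalIntegrated α (hα.orbitFunction a b),
    subset_closure (NonUnitalStarAlgebra.subset_adjoin ℂ _ (Set.mem_range_self _))⟩

theorem coe_sandwich (a b : A) : (hα.sandwich a b : RepProduct α) =
    universalIntegratedCLM α (hα.orbitFunction a b) := rfl

theorem coe_sandwich_apply (a b : A) (ρ : CovariantRep α) :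
    (hα.sandwich a b : RepProduct α) ρ = ρ.π a * ρ.circleRep.fourierProj 0 * ρ.π b :=
  ρ.integrated_orbitFunction hα a b

theorem sandwich_mul_of_mem {c : A} (hc : c ∈ fixedPointAlgebra α) (a b : A) :
    hα.sandwich (a * c) b = hα.sandwich a (c * b) := by
  ext1
  rw [coe_sandwich, coe_sandwich, orbitFunction_mul_of_mem hα hc]

theorem sandwich_mul_sandwich (a b c d : A) :
    hα.sandwich a b * hα.sandwich c d = hα.sandwich (a * hα.expectation (b * c)) d := by
  ext ρ : 3
  change (hα.sandwich a b : RepProduct α) ρ * (hα.sandwich c d : RepProduct α) ρ = _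
  have hcorner := ρ.fourierProj_mul_π_mul_fourierProj hα (b * c)
  simp only [coe_sandwich_apply, map_mul, ← mul_assoc] at hcorner ⊢
  calc ρ.π a * ρ.circleRep.fourierProj 0 * ρ.π b * ρ.π c * ρ.circleRep.fourierProj 0 * ρ.π d
      = ρ.π a * (ρ.circleRep.fourierProj 0 * ρ.π b * ρ.π c * ρ.circleRep.fourierProj 0) *
          ρ.π d := by simp only [mul_assoc]
    _ = _ := by rw [hcorner, ← mul_assoc]

theorem star_sandwich (a b : A) : star (hα.sandwich a b) = hα.sandwich (star b) (star a) := by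
  ext ρ : 3
  change star ((hα.sandwich a b : RepProduct α) ρ) = _
  rw [coe_sandwich_apply, coe_sandwich_apply, star_mul, star_mul,
    CircleRep.star_fourierProj_zero, ← map_star, ← map_star, mul_assoc]

theorem coe_mem_closure_span_sandwich (hR : RokhlinProperty α) (x : crossedProduct α) :
    (x : RepProduct α) ∈ closure (Submodule.span ℂ
      {y | ∃ a b, (hα.sandwich a b : RepProduct α) = y} : Set (RepProduct α)) := by
  refine closure_adjoin_subset_closure_span ?_ ?_ ?_ x.2
  · rintro _ ⟨a, b, rfl⟩ _ ⟨c, d, rfl⟩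
    exact ⟨_, _, congrArg Subtype.val (sandwich_mul_sandwich hα a b c d).symm⟩
  · rintro _ ⟨a, b, rfl⟩
    exact ⟨_, _, congrArg Subtype.val (star_sandwich hα a b).symm⟩
  · let K := (Submodule.span ℂ {y | ∃ a b, (hα.sandwich a b : RepProduct α) = y}).topologicalClosure
    have htop : K.comap (universalIntegratedCLM α).toLinearMap = ⊤ :=
      eq_top_of_forall_orbitFunction_mem hα hR
        ((Submodule.isClosed_topologicalClosure _).preimage (universalIntegratedCLM α).continuous)
        fun a b => subset_closure (Submodule.subset_span ⟨a, b, rfl⟩)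
    rintro _ ⟨f, rfl⟩
    exact Submodule.eq_top_iff'.mp htop f

theorem dense_span_sandwich (hR : RokhlinProperty α) :
    Dense (Submodule.span ℂ {x | ∃ a b, hα.sandwich a b = x} : Set (crossedProduct α)) := by
  intro x
  let incl : crossedProduct α →ₗ[ℂ] RepProduct α := (crossedProduct α).toSubmodule.subtype
  have himage : incl '' (Submodule.span ℂ {x | ∃ a b, hα.sandwich a b = x}) =
      (Submodule.span ℂ {y | ∃ a b, (hα.sandwich a b : RepProduct α) = y} :
        Set (RepProduct α)) := by
    rw [← Submodule.map_coe, Submodule.map_span]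
    congr 2
    aesop
  exact closure_subtype.mpr (himage.symm ▸ coe_mem_closure_span_sandwich hα hR x)

end CrossedProduct

variable (hα : IsContinuous α)

/-- The isomorphism `a ↦ a * p` of the fixed point algebra onto the corner cut out by the
projection `p`, as a map into the crossed product. -/
def IsContinuous.toCorner : fixedPointAlgebra α →⋆ₙₐ[ℂ] crossedProduct α where
  toFun a := hα.sandwich a 1
  map_smul' c a := by
    ext ρ : 3
    change _ = c • (hα.sandwich a 1 : RepProduct α) ρ
    simp only [coe_sandwich_apply, SetLike.val_smul, map_smul, smul_mul_assoc]
  map_zero' := by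
    ext ρ : 3
    rw [coe_sandwich_apply, ZeroMemClass.coe_zero, map_zero, zero_mul, zero_mul]
    rfl
  map_add' a b := by
    ext ρ : 3
    change _ = (hα.sandwich a 1 : RepProduct α) ρ + (hα.sandwich b 1 : RepProduct α) ρ
    simp only [coe_sandwich_apply, AddMemClass.coe_add, map_add, add_mul]
  map_mul' a b := by
    rw [sandwich_mul_sandwich, one_mul, expectation_coe, MulMemClass.coe_mul]
  map_star' a := by
    simpa only [star_sandwich, star_one, one_mul, mul_one, StarMemClass.coe_star] using
      sandwich_mul_of_mem hα (star a).2 1 1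

theorem toCorner_apply (a : fixedPointAlgebra α) : hα.toCorner a = hα.sandwich a 1 := rfl

theorem toCorner_one_mul_sandwich_mul_toCorner_one (a b : A) :
    hα.toCorner 1 * hα.sandwich a b * hα.toCorner 1 =
      hα.toCorner (hα.expectation a * hα.expectation b) := by
  simp only [toCorner_apply, OneMemClass.coe_one, sandwich_mul_sandwich, one_mul, mul_one,
    MulMemClass.coe_mul]

theorem sandwich_eq_mul_toCorner_one_mul (a b : A) :
    hα.sandwich a b = hα.sandwich a 1 * hα.toCorner 1 * hα.sandwich 1 b := by
  simp only [toCorner_apply, OneMemClass.coe_one, sandwich_mul_sandwich, mul_one, expectation_one]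

theorem isSimpleCStarAlgebra_crossedProduct (hα : IsContinuous α) (hR : RokhlinProperty α)
    (hS : IsSimpleCStarAlgebra (fixedPointAlgebra α)) (ρ : CovariantRep α)
    (hρ : ρ.circleRep.fourierProj 0 ≠ 0) : IsSimpleCStarAlgebra (crossedProduct α) := by
  refine isSimpleCStarAlgebra_of_dense hS (φ := hα.toCorner) (fun h => hρ ?_)
    (dense_span_sandwich hα hR) ?_ ?_
  · have h_apply : (hα.sandwich 1 1 : RepProduct α) ρ = 0 :=
      congrArg (fun x : crossedProduct α => (x : RepProduct α) ρ) h
    rwa [coe_sandwich_apply, map_one, one_mul, mul_one] at h_apply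
  · rintro _ ⟨a, b, rfl⟩
    exact ⟨_, (toCorner_one_mul_sandwich_mul_toCorner_one hα a b).symm⟩
  · rintro _ ⟨a, b, rfl⟩
    exact ⟨_, _, sandwich_eq_mul_toCorner_one_mul hα a b⟩

end CircleAction

section PositiveFunctional

open scoped ComplexOrder

variable {A : Type*} [NormedRing A] [StarRing A] [CStarRing A] [NormedAlgebra ℂ A] [StarModule ℂ A]

theorem norm_add_mul_I_smul_one_sq_le [Nontrivial A] {a : A} (ha : IsSelfAdjoint a) (t : ℝ) :
    ‖a + (t * Complex.I) • (1 : A)‖ ^ 2 ≤ ‖a‖ ^ 2 + t ^ 2 := by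
  have hstar_mul : star (a + (t * Complex.I) • (1 : A)) * (a + (t * Complex.I) • (1 : A)) =
      a * a + ((t : ℂ) ^ 2) • (1 : A) := by
    have hstar : star ((t : ℂ) * Complex.I) = -(t * Complex.I) := by simp
    have hsq : (t * Complex.I) * (t * Complex.I) = -(t : ℂ) ^ 2 := by
      rw [mul_mul_mul_comm, Complex.I_mul_I]
      ring
    simp only [star_add, ha.star_eq, star_smul, star_one, hstar, neg_smul, add_mul, mul_add,
      smul_mul_assoc, mul_smul_comm, one_mul, mul_one, neg_mul]
    rw [smul_add, smul_neg, smul_smul, hsq, neg_smul]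
    abel
  calc ‖a + (t * Complex.I) • (1 : A)‖ ^ 2
      = ‖a * a + ((t : ℂ) ^ 2) • (1 : A)‖ := by
        rw [← hstar_mul, CStarRing.norm_star_mul_self, sq]
    _ ≤ ‖a * a‖ + ‖((t : ℂ) ^ 2) • (1 : A)‖ := norm_add_le _ _
    _ ≤ ‖a‖ ^ 2 + t ^ 2 := by
        rw [norm_smul, norm_one, mul_one, norm_pow, Complex.norm_real, Real.norm_eq_abs, sq_abs,
          sq ‖a‖]
        gcongr
        exact norm_mul_le a a

/-- For every real `t` the bound `‖f (a + it)‖ ≤ ‖a + it‖` gives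
`(Im f(a) + t)² ≤ ‖a‖² + t²`, which is linear in `t` after cancellation. -/
theorem im_apply_eq_zero_of_isSelfAdjoint {f : A →L[ℂ] ℂ} (hf : ∀ a, ‖f a‖ ≤ ‖a‖) (h1 : f 1 = 1)
    {a : A} (ha : IsSelfAdjoint a) : (f a).im = 0 := by
  have : Nontrivial A := ⟨1, 0, fun h => one_ne_zero (h1.symm.trans (h ▸ map_zero f))⟩
  have hbound (t : ℝ) : ((f a).im + t) ^ 2 ≤ ‖a‖ ^ 2 + t ^ 2 := by
    have hf_add : f (a + (t * Complex.I) • (1 : A)) = f a + t * Complex.I := by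
      rw [map_add, map_smul, h1, smul_eq_mul, mul_one]
    calc ((f a).im + t) ^ 2 = |(f a + t * Complex.I).im| ^ 2 := by simp
      _ ≤ ‖a + (t * Complex.I) • (1 : A)‖ ^ 2 := by
        gcongr
        rw [← hf_add]
        exact (Complex.abs_im_le_norm _).trans (hf _)
      _ ≤ ‖a‖ ^ 2 + t ^ 2 := norm_add_mul_I_smul_one_sq_le ha t
  by_contra hne
  have htwo : 2 * ((f a).im * ((‖a‖ ^ 2 + 1) / (2 * (f a).im))) = ‖a‖ ^ 2 + 1 := by field_simp
  nlinarith [sq_nonneg (f a).im, hbound ((‖a‖ ^ 2 + 1) / (2 * (f a).im))]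

theorem apply_nonneg_of_norm_apply_le {A : Type*} [CStarAlgebra A] [PartialOrder A]
    [StarOrderedRing A] {f : A →L[ℂ] ℂ} (hf : ∀ a, ‖f a‖ ≤ ‖a‖) (h1 : f 1 = 1) {a : A}
    (ha : 0 ≤ a) : 0 ≤ f a := by
  have hsa : IsSelfAdjoint a := .of_nonneg ha
  refine Complex.nonneg_iff.mpr ⟨?_, (im_apply_eq_zero_of_isSelfAdjoint hf h1 hsa).symm⟩
  have hnorm : ‖algebraMap ℝ A ‖a‖ - a‖ ≤ ‖a‖ := by
    rw [CStarAlgebra.norm_le_iff_le_algebraMap _ (norm_nonneg a)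
      (sub_nonneg.mpr hsa.le_algebraMap_norm_self)]
    exact sub_le_self _ ha
  have hf_sub : f (algebraMap ℝ A ‖a‖ - a) = ‖a‖ - f a := by
    rw [map_sub, Algebra.algebraMap_eq_smul_one, ← Complex.coe_smul, map_smul, h1, smul_eq_mul,
      mul_one]
  have hre : ‖a‖ - (f a).re ≤ ‖a‖ :=
    calc ‖a‖ - (f a).re = (f (algebraMap ℝ A ‖a‖ - a)).re := by
          rw [hf_sub, Complex.sub_re, Complex.ofReal_re]
      _ ≤ ‖a‖ := (Complex.re_le_norm _).trans ((hf _).trans hnorm)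
  linarith

end PositiveFunctional

namespace CircleAction

open scoped ComplexOrder

section GNS

variable {A : Type*} [CStarAlgebra A] [PartialOrder A] [StarOrderedRing A] (f : A →ₚ[ℂ] ℂ)

/-- The map `a ↦ π(a) ξ` from `A` to the GNS space of `f`, where `ξ` is the cyclic vector. -/
def gnsMap : A →ₗ[ℂ] f.GNS :=
  UniformSpace.Completion.toComplₗᵢ.toLinearMap ∘ₗ f.toPreGNS.toLinearMap

theorem gnsMap_apply (a : A) : gnsMap f a = (f.toPreGNS a : f.GNS) := rfl

theorem denseRange_gnsMap : DenseRange (gnsMap f) :=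
  UniformSpace.Completion.denseRange_coe.comp f.toPreGNS.surjective.denseRange
    (UniformSpace.Completion.continuous_coe _)

theorem norm_gnsMap (a : A) : ‖gnsMap f a‖ = √(f (star a * a)).re := by
  rw [gnsMap_apply, UniformSpace.Completion.norm_coe, f.preGNS_norm_def, f.ofPreGNS_toPreGNS]

theorem continuous_gnsMap : Continuous (gnsMap f) := by
  refine continuous_of_continuousAt_zero (gnsMap f) ?_
  rw [ContinuousAt, map_zero, tendsto_zero_iff_norm_tendsto_zero]
  simp only [norm_gnsMap]
  have h : Continuous fun a => √(f (star a * a)).re := by fun_prop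
  simpa using h.tendsto 0

variable {f} in
theorem ext_gnsMap {S T : f.GNS →L[ℂ] f.GNS} (h : ∀ a, S (gnsMap f a) = T (gnsMap f a)) :
    S = T :=
  ContinuousLinearMap.coeFn_injective <|
    (denseRange_gnsMap f).equalizer S.continuous T.continuous (funext h)

theorem gnsStarAlgHom_gnsMap (a b : A) : f.gnsStarAlgHom a (gnsMap f b) = gnsMap f (a * b) :=
  f.gnsNonUnitalStarAlgHom_apply_coe

variable {f}

/-- The isometry of the GNS space of `f` which implements an automorphism preserving `f`. -/
def gnsIsometry {φ : A ≃⋆ₐ[ℂ] A} (hφ : ∀ a, f (φ a) = f a) : f.GNS ≃ₗᵢ[ℂ] f.GNS :=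
  φ.toAlgEquiv.toLinearEquiv.extendOfIsometry (gnsMap f) (gnsMap f) (denseRange_gnsMap f)
    (denseRange_gnsMap f) fun a => by
      change ‖gnsMap f (φ a)‖ = ‖gnsMap f a‖
      rw [norm_gnsMap, norm_gnsMap, ← map_star, ← map_mul, hφ]

theorem gnsIsometry_gnsMap {φ : A ≃⋆ₐ[ℂ] A} (hφ : ∀ a, f (φ a) = f a) (a : A) :
    gnsIsometry hφ (gnsMap f a) = gnsMap f (φ a) :=
  LinearEquiv.extendOfIsometry_eq ..

variable {G : Type*} [Monoid G] {α : G →* (A ≃⋆ₐ[ℂ] A)} (hf : ∀ s a, f (α s a) = f a)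

/-- The unitary representation on the GNS space of `f` induced by an action preserving `f`. -/
def gnsUnitary : G →* unitary (f.GNS →L[ℂ] f.GNS) where
  toFun s := Unitary.linearIsometryEquiv.symm (gnsIsometry (hf s))
  map_one' := Subtype.ext <| ext_gnsMap fun a =>
    (gnsIsometry_gnsMap (hf 1) a).trans (by rw [map_one]; rfl)
  map_mul' s t := Subtype.ext <| ext_gnsMap fun a => by
    change gnsIsometry (hf (s * t)) (gnsMap f a) =
      gnsIsometry (hf s) (gnsIsometry (hf t) (gnsMap f a))
    simp only [gnsIsometry_gnsMap, map_mul, StarAlgEquiv.mul_apply]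

theorem gnsUnitary_apply (s : G) (ξ : f.GNS) :
    (gnsUnitary hf s : f.GNS →L[ℂ] f.GNS) ξ = gnsIsometry (hf s) ξ := rfl

theorem gnsUnitary_gnsMap (s : G) (a : A) :
    (gnsUnitary hf s : f.GNS →L[ℂ] f.GNS) (gnsMap f a) = gnsMap f (α s a) :=
  gnsIsometry_gnsMap (hf s) a

theorem continuous_gnsUnitary [TopologicalSpace G] (hα : ∀ a, Continuous fun s => α s a)
    (ξ : f.GNS) : Continuous fun s => (gnsUnitary hf s : f.GNS →L[ℂ] f.GNS) ξ := by
  refine continuous_of_uniform_approx_of_continuous fun u hu => ?_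
  obtain ⟨ε, hε, hεu⟩ := Metric.mem_uniformity_dist.mp hu
  obtain ⟨a, ha⟩ := (denseRange_gnsMap f).exists_dist_lt ξ hε
  refine ⟨fun s => (gnsUnitary hf s : f.GNS →L[ℂ] f.GNS) (gnsMap f a), ?_, fun s => hεu ?_⟩
  · simp only [gnsUnitary_gnsMap]
    exact (continuous_gnsMap f).comp (hα a)
  · simpa only [gnsUnitary_apply, LinearIsometryEquiv.dist_map] using ha

theorem gnsUnitary_mul_gnsStarAlgHom (s : G) (a : A) :
    (gnsUnitary hf s : f.GNS →L[ℂ] f.GNS) * f.gnsStarAlgHom a =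
      f.gnsStarAlgHom (α s a) * gnsUnitary hf s :=
  ext_gnsMap fun b => by
    rw [mul_apply_eq_comp, mul_apply_eq_comp, gnsStarAlgHom_gnsMap, gnsUnitary_gnsMap,
      gnsUnitary_gnsMap, gnsStarAlgHom_gnsMap, map_mul (α s)]

end GNS

section GNSCovariantRep

variable {A : Type u} [CStarAlgebra A] [PartialOrder A] [StarOrderedRing A] {f : A →ₚ[ℂ] ℂ}
  {α : Circle →* (A ≃⋆ₐ[ℂ] A)} (hf : ∀ s a, f (α s a) = f a) (hα : IsContinuous α)

/-- The covariant GNS representation of an invariant positive functional. -/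
def gnsCovariantRep : CovariantRep α where
  H := f.GNS
  π := f.gnsStarAlgHom
  v := gnsUnitary hf
  continuous_v := continuous_gnsUnitary hf hα
  covariant s a := by
    rw [gnsUnitary_mul_gnsStarAlgHom, mul_assoc,
      Unitary.mul_star_self_of_mem (gnsUnitary hf s).2, mul_one]

theorem fourierProj_zero_gnsMap_one :
    (gnsCovariantRep hf hα).circleRep.fourierProj 0 (gnsMap f 1) = gnsMap f 1 := by
  let ρ := gnsCovariantRep hf hα
  let ξ : ρ.H := gnsMap f 1
  have hfixed : ξ ∈ ρ.circleRep.spectralSubspace 0 := fun s => by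
    rw [zpow_zero, one_smul]
    exact (gnsUnitary_gnsMap hf s 1).trans (congrArg (gnsMap f) (map_one (α s)))
  exact (ρ.circleRep.fourierProj_of_mem_spectralSubspace hfixed 0).trans (if_pos rfl)

end GNSCovariantRep

theorem exists_covariantRep_fourierProj_ne_zero {A : Type u} [CStarAlgebra A] [Nontrivial A]
    {α : Circle →* (A ≃⋆ₐ[ℂ] A)} (hα : IsContinuous α) :
    ∃ ρ : CovariantRep α, ρ.circleRep.fourierProj 0 ≠ 0 := by
  let _ := CStarAlgebra.spectralOrder A
  have := CStarAlgebra.spectralOrderedRing A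
  obtain ⟨p, hp, hp1⟩ := exists_dual_vector ℂ (1 : A) (by simp)
  let E := hα.circleRep.fourierProj 0
  have hE_one : E 1 = 1 := congrArg Subtype.val (expectation_one hα)
  have hnorm (a : A) : ‖(p ∘L E) a‖ ≤ ‖a‖ := by
    refine (p.le_opNorm _).trans ?_
    rw [hp, one_mul]
    exact hα.circleRep.norm_fourierProj_apply_le 0 a
  have hone : (p ∘L E) 1 = 1 := by
    rw [ContinuousLinearMap.comp_apply, hE_one, hp1, norm_one, RCLike.ofReal_one]
  let f : A →ₚ[ℂ] ℂ := PositiveLinearMap.mk₀ (p ∘L E).toLinearMap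
    fun a ha => apply_nonneg_of_norm_apply_le hnorm hone ha
  have hf (s : Circle) (a : A) : f (α s a) = f a :=
    congrArg (fun c : fixedPointAlgebra α => p c) (expectation_apply hα s a)
  refine ⟨gnsCovariantRep hf hα, fun hzero => ?_⟩
  have hξ : gnsMap f 1 = 0 := by
    rw [← fourierProj_zero_gnsMap_one hf hα, hzero]
    rfl
  have hξ_norm : ‖gnsMap f 1‖ = 1 := by
    have hf_one : f 1 = 1 := hone
    rw [norm_gnsMap, star_one, one_mul, hf_one, Complex.one_re, Real.sqrt_one]
  rw [hξ, norm_zero] at hξ_norm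
  exact zero_ne_one hξ_norm

end CircleAction

end

theorem mainTheorem11_general {A : Type*} [CStarAlgebra A] (α : Circle →* (A ≃⋆ₐ[ℂ] A))
    (hA : CircleAction.IsActionSimple α) (hα : CircleAction.IsContinuous α)
    (hR : CircleAction.RokhlinProperty α) :
    IsSimpleCStarAlgebra (CircleAction.fixedPointAlgebra α) ∧
      IsSimpleCStarAlgebra (CircleAction.crossedProduct α) := by
  have : Nontrivial A := hA.1
  have hfixed := CircleAction.isSimpleCStarAlgebra_fixedPointAlgebra hA hα hR
  obtain ⟨ρ, hρ⟩ := CircleAction.exists_covariantRep_fourierProj_ne_zero hα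
  exact ⟨hfixed, CircleAction.isSimpleCStarAlgebra_crossedProduct hα hR hfixed ρ hρ⟩

theorem mainTheorem11 {A : Type*} [CStarAlgebra A] (hA : IsSimpleCStarAlgebra A)
    (α : Circle →* (A ≃⋆ₐ[ℂ] A)) (hα : CircleAction.IsContinuous α)
    (hR : CircleAction.RokhlinProperty α) :
    IsSimpleCStarAlgebra (CircleAction.fixedPointAlgebra α) ∧
      IsSimpleCStarAlgebra (CircleAction.crossedProduct α) :=
  mainTheorem11_general α (CircleAction.isActionSimple_of_isSimpleCStarAlgebra hA α) hα hR
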